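/- Let $K$ and $L$ be finite geometric simplicial complexes, with underlying spaces $|K|$, $|L|$ and vertex sets $K^{(0)}$, $L^{(0)}$; choose a total order on $K^{(0)}$. Let $f\colon |K|\to |L|$ be a simplicial map, i.e. $f$ sends vertices to vertices, sends the vertices of each simplex of $K$ onto the vertices of a simplex of $L$, and satisfies $f(\sum_i\lambda_i v_i)=\sum_i\lambda_i f(v_i)$ in barycentric coordinates on each simplex. The (topological) mapping cylinder $M(f)$ is the quotient of $(|K|\times[0,1])\sqcup|L|$ by the equivalence relation generated by $(x,1)\sim f(x)$, with the quotient topology. Let $K\times I$ be the ordered product triangulation: the abstract simplicial complex with vertex set $K^{(0)}\times\{0,1\}$ whose simplices are the nonempty finite subsets that are totally ordered for the componentwise order and whose projection to $K^{(0)}$ is a simplex of $K$. Equivalently, they are the nonempty subsets of the sets $\{(x_0,0),\dots,(x_k,0),(x_k,1),\dots,(x_m,1)\}$, where $x_0<\dots<x_m$ are the vertices of a simplex of $K$ and $0\le k\le m$. The simplicial mapping cylinder $\mathrm{Cyl}(f)$ is the abstract simplicial complex with vertex set $K^{(0)}\sqcup L^{(0)}$ whose simplices are the simplices of $L$ and the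 images of the simplices of $K\times I$ under the vertex map $(v,0)\mapsto v\in K^{(0)}$, $(v,1)\mapsto f(v)\in L^{(0)}$. Let $|\mathrm{Cyl}(f)|$ be the underlying space of any geometric realization of $\mathrm{Cyl}(f)$, and for $v\in K^{(0)}\sqcup L^{(0)}$ let $\bar v\in|\mathrm{Cyl}(f)|$ be the corresponding vertex. Then there is exactly one continuous map $q\colon M(f)\to|\mathrm{Cyl}(f)|$ such that: - for every simplex $s$ of $K\times I$ and all weights $w_a\ge 0$ ($a\in s$) with $\sum_{a\in s} w_a=1$, $q$ sends the class of the point $\bigl(\sum_{(v,\varepsilon)\in s}w_{(v,\varepsilon)}v,\ \sum_{(v,\varepsilon)\in s}w_{(v,\varepsilon)}\varepsilon\bigr)\in|K|\times[0,1]$ to $\sum_{(v,0)\in s}w_{(v,0)}\bar v+\sum_{(v,1)\in s}w_{(v,1)}\overline{f(v)}$; - for every simplex $\sigma$ of $L$ and all weights $w_u\ge 0$ ($u\in\sigma$) with $\sum_{u\in\sigma} w_u=1$, $q$ sends the class of $\sum_{u\in\sigma}w_u u\in|L|$ to $\sum_{u\in\sigma}w_u\bar u$. This map $q$ (the natural quotient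 map) is a homotopy equivalence. -/

import Mathlib

open Geometry

noncomputable section

/-- The gluing relation of the mapping cylinder: `(x, 1) ∼ f x`. -/
inductive MappingCylinder.Rel {X Y : Type*} (f : X → Y) :
    (X × unitInterval) ⊕ Y → (X × unitInterval) ⊕ Y → Prop
  | glue (x : X) : MappingCylinder.Rel f (Sum.inl (x, 1)) (Sum.inr (f x))

/-- The topological mapping cylinder `M(f) = (X × [0,1]) ⊔ Y / ((x, 1) ∼ f x)`: the quotient by the
equivalence relation generated by the gluing relation. -/
def MappingCylinder {X Y : Type*} (f : X → Y) : Type _ := Quot (MappingCylinder.Rel f)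

/-- `M(f)` carries the quotient topology of the disjoint union `(X × [0,1]) ⊔ Y`. -/
instance {X Y : Type*} [TopologicalSpace X] [TopologicalSpace Y] (f : X → Y) :
    TopologicalSpace (MappingCylinder f) :=
  inferInstanceAs (TopologicalSpace (Quot (MappingCylinder.Rel f)))

/-- The quotient map `h : (X × [0,1]) ⊔ Y → M(f)`. -/
def MappingCylinder.mk {X Y : Type*} (f : X → Y) (z : (X × unitInterval) ⊕ Y) :
    MappingCylinder f := Quot.mk _ z

/-- The abstract simplicial complex underlying a geometric one: its vertices are the vertices
of `K`, its simplices are the sets of vertices that span a simplex of `K`. -/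
def Geometry.SimplicialComplex.underlying {E : Type*} [AddCommGroup E] [Module ℝ E]
    (K : SimplicialComplex ℝ E) : AbstractSimplicialComplex K.vertices where
  faces := {s | s.map (Function.Embedding.subtype _) ∈ K.faces}
  isRelLowerSet_faces := by
    intro s hs
    refine ⟨by simpa using K.nonempty_of_mem_faces hs, fun t hts ht => ?_⟩
    exact K.down_closed hs (Finset.map_subset_map.2 hts) (by simpa using ht)
  singleton_mem := by
    intro v
    have hv : {(v : E)} ∈ K.faces := v.2
    change Finset.map _ {v} ∈ K.faces
    rw [Finset.map_singleton]
    exact hv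

/-- `w` gives barycentric coordinates with respect to the vertices in `s`. -/
def IsBarycentric {V : Type*} (s : Finset V) (w : V → ℝ) : Prop :=
  (∀ v ∈ s, 0 ≤ w v) ∧ ∑ v ∈ s, w v = 1

open Classical in
/-- A simplicial map between geometric simplicial complexes: a map of the underlying spaces which
sends vertices to vertices, the vertices of a simplex to the vertices of a simplex, and which on
each simplex is `∑ w v • v ↦ ∑ w v • f v` in barycentric coordinates. -/
structure GeometricSimplicialMap {E F : Type*} [AddCommGroup E] [Module ℝ E]
    [AddCommGroup F] [Module ℝ F] (K : SimplicialComplex ℝ E) (L : SimplicialComplex ℝ F) where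
  /-- the map of underlying spaces -/
  toFun : K.space → L.space
  /-- its restriction to the vertices -/
  vertexMap : K.vertices → L.vertices
  map_faces : ∀ s ∈ K.underlying.faces, s.image vertexMap ∈ L.underlying.faces
  map_barycentric : ∀ s ∈ K.underlying.faces, ∀ w : K.vertices → ℝ, IsBarycentric s w →
    ∀ x : K.space, (x : E) = ∑ v ∈ s, w v • (v : E) →
      (toFun x : F) = ∑ v ∈ s, w v • (vertexMap v : F)

open Classical in
/-- The product of two abstract simplicial complexes with totally ordered vertices: the simplices
are the nonempty finite sets of pairs which are totally ordered for the componentwise order and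
whose two projections are simplices. -/
def AbstractSimplicialComplex.orderedProd {V W : Type*} [LinearOrder V] [LinearOrder W]
    (A : AbstractSimplicialComplex V) (B : AbstractSimplicialComplex W) :
    AbstractSimplicialComplex (V × W) where
  faces := {s | IsChain (· ≤ ·) (s : Set (V × W)) ∧
    s.image Prod.fst ∈ A.faces ∧ s.image Prod.snd ∈ B.faces}
  isRelLowerSet_faces := by
    rintro s ⟨hc, hA, hB⟩
    refine ⟨by simpa using (A.isRelLowerSet_faces hA).1, fun t hts ht => ⟨?_, ?_, ?_⟩⟩
    · exact hc.mono (Finset.coe_subset.2 hts)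
    · exact (A.isRelLowerSet_faces hA).2 (Finset.image_subset_image hts) (ht.image _)
    · exact (B.isRelLowerSet_faces hB).2 (Finset.image_subset_image hts) (ht.image _)
  singleton_mem := by
    rintro ⟨v, w⟩
    exact ⟨by simp, by simpa using A.singleton_mem v, by simpa using B.singleton_mem w⟩

/-- The triangulated product `K × I`, where `I` is the standard 1-simplex with vertices `0 < 1`.
Its simplices are the nonempty subsets of the sets
`{(x₀, 0), …, (xₖ, 0), (xₖ, 1), …, (xₘ, 1)}`, for simplices `{x₀ < ⋯ < xₘ}` of `K`. -/
def AbstractSimplicialComplex.prodI {V : Type*} [LinearOrder V]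
    (A : AbstractSimplicialComplex V) : AbstractSimplicialComplex (V × Fin 2) :=
  A.orderedProd ⊤

/-- The vertex map `K × I → K ⊔ L` of the gluing: the inner layer is kept and the outer
layer is sent to `L` by `f`. -/
def cylinderVertexMap {V W : Type*} (f : V → W) (a : V × Fin 2) : V ⊕ W :=
  if a.2 = 0 then Sum.inl a.1 else Sum.inr (f a.1)

open Classical in
/-- The simplicial mapping cylinder: vertex set `V ⊔ W`; the simplices are those of `B` and the
images of the simplices of `A × I`. -/
def simplicialMappingCylinder {V W : Type*} [LinearOrder V]
    (A : AbstractSimplicialComplex V) (B : AbstractSimplicialComplex W) (f : V → W) :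
    AbstractSimplicialComplex (V ⊕ W) where
  toPreAbstractSimplicialComplex :=
    B.toPreAbstractSimplicialComplex.map Sum.inr ⊔
      A.prodI.toPreAbstractSimplicialComplex.map (cylinderVertexMap f)
  singleton_mem := by
    rintro (v | w)
    · exact Or.inr ⟨{(v, 0)}, A.prodI.singleton_mem _, by simp [cylinderVertexMap]⟩
    · exact Or.inl ⟨{w}, B.singleton_mem _, by simp⟩

open Classical in
/-- A geometric realization of the abstract complex `A` in the vector space `G`: a geometric
simplicial complex together with an identification of its underlying abstract complex with `A`. -/
structure GeometricRealization {V : Type*} (A : AbstractSimplicialComplex V)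
    (G : Type*) [AddCommGroup G] [Module ℝ G] where
  /-- the geometric complex -/
  complex : SimplicialComplex ℝ G
  /-- the point representing a vertex -/
  point : V → G
  point_injective : Function.Injective point
  faces_eq : complex.faces = (fun s : Finset V => s.image point) '' A.faces

/-- Every abstract complex on a finite vertex set has a geometric realization, with the standard
basis vectors as vertices. -/
theorem GeometricRealization.nonempty_standard {V : Type*} [Finite V]
    (A : AbstractSimplicialComplex V) : Nonempty (GeometricRealization A (V → ℝ)) := by
  classical
  have hinj : Function.Injective (fun v : V => (Pi.single v 1 : V → ℝ)) :=
    (Pi.linearIndependent_single_one V ℝ).injective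
  refine ⟨⟨SimplicialComplex.ofAffineIndependent
    (A.toPreAbstractSimplicialComplex.map (fun v : V => (Pi.single v 1 : V → ℝ))) ?_,
    fun v => Pi.single v 1, hinj, ?_⟩⟩
  · refine (Pi.linearIndependent_single_one V ℝ).affineIndependent.range.mono fun x hx => ?_
    simp only [Set.mem_iUnion, Finset.mem_coe] at hx
    obtain ⟨_, ⟨s, _, rfl⟩, hx⟩ := hx
    obtain ⟨v, _, rfl⟩ := Finset.mem_image.1 hx
    exact ⟨v, rfl⟩
  · simp only [SimplicialComplex.ofAffineIndependent, PreAbstractSimplicialComplex.map]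

/-- `q` is the map `M(f) → |C|`, `C` a realization of the simplicial mapping cylinder of `f`, to
which the linear extension of `cylinderVertexMap` on `|K × I| = |K| × [0,1]` and the inclusion
of `|L|` descend. On the simplex of `K × I` with vertices `a = (v, ε)` in `s`, the point of
`|K| × [0,1]` with coordinates `w` is `(∑ w a • v, ∑ w a • ε)`. -/
structure IsCylinderMap {E F G : Type*} [AddCommGroup E] [Module ℝ E]
    [AddCommGroup F] [Module ℝ F] [AddCommGroup G] [Module ℝ G]
    {K : SimplicialComplex ℝ E} {L : SimplicialComplex ℝ F} [LinearOrder K.vertices]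
    (f : GeometricSimplicialMap K L)
    (C : GeometricRealization
      (simplicialMappingCylinder K.underlying L.underlying f.vertexMap) G)
    (q : MappingCylinder f.toFun → C.complex.space) : Prop where
  on_prod : ∀ s ∈ K.underlying.prodI.faces, ∀ w : K.vertices × Fin 2 → ℝ, IsBarycentric s w →
    ∀ (x : K.space) (t : unitInterval),
      (x : E) = ∑ a ∈ s, w a • (a.1 : E) → (t : ℝ) = ∑ a ∈ s, w a * ((a.2 : ℕ) : ℝ) →
        (q (MappingCylinder.mk f.toFun (Sum.inl (x, t))) : G) =
          ∑ a ∈ s, w a • C.point (cylinderVertexMap f.vertexMap a)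
  on_base : ∀ s ∈ L.underlying.faces, ∀ w : L.vertices → ℝ, IsBarycentric s w →
    ∀ y : L.space, (y : F) = ∑ v ∈ s, w v • (v : F) →
      (q (MappingCylinder.mk f.toFun (Sum.inr y)) : G) = ∑ v ∈ s, w v • C.point (Sum.inr v)

end

/-!
Everything is computed in barycentric coordinates. Because the complexes are finite, the underlying
space of a realization is homeomorphic to the compact set of probability vectors supported on a
face (`GeometricRealization.homeomorph`), so maps into and out of `|K|`, `|L|` and `|Cyl(f)|` may
be given by formulas in coordinates.

The main tool is a single flow on `|Cyl(f)|` (`cylinderFlow`). A point distributes a unit mass over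
the vertices. Running through the vertices of `K` from the largest downwards, the flow carries the
first `t` units of the mass lying on them along `f` to `L`; the amount `topPart b t v` leaving the
vertex `v` is continuous in the point and in `t`. What stays behind is not above anything that
has moved, so the vertices in use still form the image of a chain of `K × I`, and the flow does not
leave the complex (`cylinderFlow_mem_polyhedron`). At time `0` it is the identity, at time `1` the
retraction `r` of `|Cyl(f)|` onto `|L|` induced by the vertex map `f ⊔ id`. Hence `r`
followed by the inclusion of `|L|` is homotopic to the identity of `|Cyl(f)|`.

The same selection of mass gives the coordinates of a point `(x, t)` of `|K| × [0, 1]` in the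
triangulation `K × I`: the topmost `t` units of the mass of `x` go to the outer layer
(`prodCoord`). These are the only possible coordinates (`eq_topPart`, `prodCoord_projections`),
whence existence and uniqueness of `q`: the point `q (x, t)` is reached by the flow at time `t` from
the copy of `x` in the inner layer.

The homotopy inverse of `q` is `r` followed by the inclusion of `|L|` in `M(f)`. One composite is
homotopic to the identity by the flow; the other is the collapse of `M(f)` onto its base, homotopic
to the identity by sliding along `[0, 1]`.
-/

/-! ### Polyhedra in barycentric coordinates -/

/-- The standard polyhedron of an abstract simplicial complex on a finite vertex set, in
barycentric coordinates: the probability vectors whose support lies in a face. -/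
def AbstractSimplicialComplex.polyhedron {V : Type*} [Fintype V]
    (A : AbstractSimplicialComplex V) : Set (V → ℝ) :=
  {b | (∀ v, 0 ≤ b v) ∧ ∑ v, b v = 1 ∧ ∃ s ∈ A.faces, ∀ v ∉ s, b v = 0}

namespace AbstractSimplicialComplex

theorem isCompact_polyhedron {V : Type*} [Fintype V] (A : AbstractSimplicialComplex V) :
    IsCompact A.polyhedron := by
  have h : A.polyhedron = ⋃ s ∈ A.faces, stdSimplex ℝ V ∩ {b | ∀ v ∉ s, b v = 0} := by
    ext b
    simp only [polyhedron, stdSimplex, Set.mem_ofPred_eq, Set.mem_iUnion, Set.mem_inter_iff,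
      exists_prop]
    tauto
  rw [h]
  refine A.faces.toFinite.isCompact_biUnion fun s _ => (isCompact_stdSimplex ℝ V).inter_right ?_
  simp only [Set.ofPred_forall]
  exact isClosed_iInter fun v => isClosed_iInter fun _ =>
    isClosed_eq (continuous_apply v) continuous_const

instance {V : Type*} [Fintype V] (A : AbstractSimplicialComplex V) : CompactSpace A.polyhedron :=
  isCompact_iff_compactSpace.1 A.isCompact_polyhedron

end AbstractSimplicialComplex

theorem sum_indicator_smul {V G : Type*} [Fintype V] [AddCommGroup G] [Module ℝ G]
    (s : Finset V) (w : V → ℝ) (p : V → G) :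
    ∑ v, (s : Set V).indicator w v • p v = ∑ v ∈ s, w v • p v := by
  classical
  simp [Set.indicator_apply, ite_smul, Finset.sum_ite_mem]

theorem sum_smul_eq_sum_univ {V G : Type*} [Fintype V] [AddCommGroup G] [Module ℝ G]
    {s : Finset V} {b : V → ℝ} (hb : ∀ v ∉ s, b v = 0) (p : V → G) :
    ∑ v ∈ s, b v • p v = ∑ v, b v • p v :=
  Finset.sum_subset (Finset.subset_univ s) fun v _ hv => by simp [hb v hv]

theorem AbstractSimplicialComplex.exists_face_of_mem_polyhedron {V : Type*} [Fintype V]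
    {A : AbstractSimplicialComplex V} {b : V → ℝ} (hb : b ∈ A.polyhedron) :
    ∃ s ∈ A.faces, IsBarycentric s b ∧ ∀ v ∉ s, b v = 0 := by
  obtain ⟨h0, h1, s, hs, hbs⟩ := hb
  refine ⟨s, hs, ⟨fun v _ => h0 v, ?_⟩, hbs⟩
  rw [← h1]
  exact Finset.sum_subset (Finset.subset_univ s) fun v _ hv => hbs v hv

theorem IsBarycentric.indicator_mem_polyhedron {V : Type*} [Fintype V]
    {A : AbstractSimplicialComplex V} {s : Finset V} {w : V → ℝ} (hw : IsBarycentric s w)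
    (hs : s ∈ A.faces) : (s : Set V).indicator w ∈ A.polyhedron := by
  refine ⟨fun v => Set.indicator_nonneg (fun v hv => hw.1 v hv) v, ?_, s, hs, fun v hv => ?_⟩
  · simpa [hw.2] using sum_indicator_smul s w (fun _ => (1 : ℝ))
  · exact Set.indicator_of_notMem (by simpa using hv) _

theorem FunOnFinite.sum_map_smul {V W G : Type*} [Fintype V] [Fintype W] [AddCommGroup G]
    [Module ℝ G] (f : V → W) (b : V → ℝ) (p : W → G) :
    ∑ w, FunOnFinite.map f b w • p w = ∑ v, b v • p (f v) := by
  classical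
  simp_rw [FunOnFinite.map_apply_apply, Finset.sum_smul]
  rw [← Finset.sum_fiberwise Finset.univ f (fun v => b v • p (f v))]
  refine Finset.sum_congr rfl fun w _ => Finset.sum_congr rfl fun v hv => ?_
  rw [(Finset.mem_filter.1 hv).2]

theorem FunOnFinite.map_nonneg {V W : Type*} [Fintype V] [Fintype W] (f : V → W) {b : V → ℝ}
    (hb : ∀ v, 0 ≤ b v) (w : W) : 0 ≤ FunOnFinite.map f b w := by
  classical
  rw [FunOnFinite.map_apply_apply]
  exact Finset.sum_nonneg fun v _ => hb v

theorem FunOnFinite.sum_map {V W : Type*} [Fintype V] [Fintype W] (f : V → W) (b : V → ℝ) :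
    ∑ w, FunOnFinite.map f b w = ∑ v, b v := by
  simpa using FunOnFinite.sum_map_smul f b (fun _ => (1 : ℝ))

theorem FunOnFinite.exists_of_map_ne_zero {V W : Type*} [Fintype V] [Fintype W] {f : V → W}
    {b : V → ℝ} {w : W} (h : FunOnFinite.map f b w ≠ 0) : ∃ v, f v = w ∧ b v ≠ 0 := by
  classical
  rw [FunOnFinite.map_apply_apply] at h
  obtain ⟨v, hv, hb⟩ := Finset.exists_ne_zero_of_sum_ne_zero h
  exact ⟨v, (Finset.mem_filter.1 hv).2, hb⟩

/-! ### Geometric realizations are homeomorphic to the standard polyhedron -/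

namespace GeometricRealization

variable {V G : Type*} {A : AbstractSimplicialComplex V}

section Algebra
variable [AddCommGroup G] [Module ℝ G] (R : GeometricRealization A G)

open Classical in
theorem image_point_mem_faces {s : Finset V} (hs : s ∈ A.faces) :
    s.image R.point ∈ R.complex.faces := by
  rw [R.faces_eq]
  exact ⟨s, hs, rfl⟩

theorem affineIndependent_face {s : Finset V} (hs : s ∈ A.faces) :
    AffineIndependent ℝ (fun v : s => R.point v) := by
  classical
  have h := R.complex.indep (R.image_point_mem_faces hs)
  exact h.comp_embedding ⟨fun v : s => ⟨R.point v, Finset.mem_image_of_mem _ v.2⟩,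
    fun a b hab => Subtype.ext (R.point_injective (congrArg Subtype.val hab))⟩

theorem mem_convexHull_image_point {s : Finset V} {x : G} :
    x ∈ convexHull ℝ (R.point '' (s : Set V)) ↔
      ∃ w : V → ℝ, IsBarycentric s w ∧ ∑ v ∈ s, w v • R.point v = x := by
  classical
  rw [← Finset.coe_image, Finset.mem_convexHull']
  have hinj : Set.InjOn R.point s := R.point_injective.injOn
  constructor
  · rintro ⟨w, h0, h1, hx⟩
    rw [Finset.sum_image hinj] at h1 hx
    exact ⟨w ∘ R.point, ⟨fun v hv => h0 _ (Finset.mem_image_of_mem _ hv), h1⟩, hx⟩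
  · rintro ⟨w, ⟨h0, h1⟩, hx⟩
    have hext : ∀ v, Function.extend R.point w 0 (R.point v) = w v :=
      fun v => R.point_injective.extend_apply w 0 v
    refine ⟨Function.extend R.point w 0, ?_, ?_, ?_⟩
    · simpa [hext] using h0
    · rw [Finset.sum_image hinj]
      simpa [hext] using h1
    · rw [Finset.sum_image hinj]
      simpa [hext] using hx

theorem mem_space_iff_exists_isBarycentric {x : G} :
    x ∈ R.complex.space ↔
      ∃ s ∈ A.faces, ∃ w : V → ℝ, IsBarycentric s w ∧ ∑ v ∈ s, w v • R.point v = x := by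
  classical
  rw [SimplicialComplex.mem_space_iff, R.faces_eq]
  simp only [Set.exists_mem_image, Finset.coe_image, R.mem_convexHull_image_point]

variable [Fintype V]

theorem sum_smul_point_mem_convexHull {s : Finset V} {b : V → ℝ} (hb : IsBarycentric s b)
    (hs : ∀ v ∉ s, b v = 0) :
    ∑ v, b v • R.point v ∈ convexHull ℝ (R.point '' (s : Set V)) :=
  R.mem_convexHull_image_point.2 ⟨b, hb, sum_smul_eq_sum_univ hs _⟩

theorem sum_smul_point_mem_space {b : V → ℝ} (hb : b ∈ A.polyhedron) :
    ∑ v, b v • R.point v ∈ R.complex.space := by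
  classical
  obtain ⟨s, hs, hbar, hbs⟩ := AbstractSimplicialComplex.exists_face_of_mem_polyhedron hb
  refine SimplicialComplex.mem_space_iff.2 ⟨_, R.image_point_mem_faces hs, ?_⟩
  rw [Finset.coe_image]
  exact R.sum_smul_point_mem_convexHull hbar hbs

theorem eq_of_sum_smul_point_eq {s : Finset V} (hs : s ∈ A.faces) {b c : V → ℝ}
    (hb : ∀ v ∉ s, b v = 0) (hc : ∀ v ∉ s, c v = 0) (hsum : ∑ v, b v = ∑ v, c v)
    (h : ∑ v, b v • R.point v = ∑ v, c v • R.point v) : b = c := by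
  have hres : ∀ {a : V → ℝ}, (∀ v ∉ s, a v = 0) →
      ∑ v : s, a v = ∑ v, a v ∧ ∑ v : s, a v • R.point v = ∑ v, a v • R.point v := by
    intro a ha
    rw [Finset.sum_coe_sort s a, Finset.sum_coe_sort s (fun v => a v • R.point v)]
    exact ⟨Finset.sum_subset (Finset.subset_univ s) fun v _ hv => ha v hv,
      sum_smul_eq_sum_univ ha _⟩
  have key := affineIndependent_iff.1 (R.affineIndependent_face hs) Finset.univ
    (fun v => b v - c v)
    (by rw [Finset.sum_sub_distrib, (hres hb).1, (hres hc).1, hsum, sub_self])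
    (by simp_rw [sub_smul]; rw [Finset.sum_sub_distrib, (hres hb).2, (hres hc).2, h, sub_self])
  funext v
  by_cases hv : v ∈ s
  · exact sub_eq_zero.1 (key ⟨v, hv⟩ (Finset.mem_univ _))
  · rw [hb v hv, hc v hv]

/-- Barycentric coordinates are unique: a point carried by two faces is carried by their
intersection, and there affine independence in either face pins the coordinates down. -/
theorem injOn_sum_smul_point :
    Set.InjOn (fun b : V → ℝ => ∑ v, b v • R.point v) A.polyhedron := by
  classical
  intro b hb c hc hbc
  obtain ⟨s, hs, hbbar, hbs⟩ := AbstractSimplicialComplex.exists_face_of_mem_polyhedron hb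
  obtain ⟨t, ht, hcbar, hct⟩ := AbstractSimplicialComplex.exists_face_of_mem_polyhedron hc
  dsimp only at hbc
  have hmem : ∑ v, b v • R.point v ∈ convexHull ℝ (R.point '' ((s ∩ t : Finset V) : Set V)) := by
    have h := R.complex.inter_subset_convexHull (R.image_point_mem_faces hs)
      (R.image_point_mem_faces ht)
      ⟨by simpa using R.sum_smul_point_mem_convexHull hbbar hbs,
        by simpa [hbc] using R.sum_smul_point_mem_convexHull hcbar hct⟩
    rwa [Finset.coe_image, Finset.coe_image, ← Set.image_inter R.point_injective,
      ← Finset.coe_inter] at h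
  obtain ⟨w, ⟨-, hw1⟩, hwx⟩ := R.mem_convexHull_image_point.1 hmem
  set d : V → ℝ := ((s ∩ t : Finset V) : Set V).indicator w with hd
  have hdx : ∑ v, d v • R.point v = ∑ v, b v • R.point v := by
    rw [hd, sum_indicator_smul, hwx]
  have hd1 : ∑ v, d v = 1 := by
    simpa [hd, hw1] using sum_indicator_smul (s ∩ t) w (fun _ => (1 : ℝ))
  have hd0 : ∀ v ∉ s ∩ t, d v = 0 := fun v hv => Set.indicator_of_notMem (by simpa using hv) _
  have h1 := R.eq_of_sum_smul_point_eq hs hbs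
    (fun v hv => hd0 v fun h => hv (Finset.mem_inter.1 h).1) (by rw [hb.2.1, hd1]) hdx.symm
  have h2 := R.eq_of_sum_smul_point_eq ht hct
    (fun v hv => hd0 v fun h => hv (Finset.mem_inter.1 h).2) (by rw [hc.2.1, hd1])
    (hbc.symm.trans hdx.symm)
  rw [h1, h2]

end Algebra

section Topology
variable [Fintype V] [NormedAddCommGroup G] [NormedSpace ℝ G] (R : GeometricRealization A G)

/-- The homeomorphism from the standard polyhedron onto the underlying space of a realization,
given by barycentric coordinates. -/
noncomputable def homeomorph : A.polyhedron ≃ₜ R.complex.space :=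
  Continuous.homeoOfEquivCompactToT2
    (f := Equiv.ofBijective
      (fun b : A.polyhedron => (⟨∑ v, b.1 v • R.point v, R.sum_smul_point_mem_space b.2⟩ :
        R.complex.space))
      ⟨fun b c h => Subtype.ext (R.injOn_sum_smul_point b.2 c.2 (congrArg Subtype.val h)), by
        rintro ⟨x, hx⟩
        obtain ⟨s, hs, w, hw, rfl⟩ := R.mem_space_iff_exists_isBarycentric.1 hx
        exact ⟨⟨_, hw.indicator_mem_polyhedron hs⟩, Subtype.ext (sum_indicator_smul s w _)⟩⟩)
    (by
      refine Continuous.subtype_mk (continuous_finsetSum _ fun v _ => ?_) _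
      exact ((continuous_apply v).comp continuous_subtype_val).smul continuous_const)

theorem coe_homeomorph (b : A.polyhedron) :
    (R.homeomorph b : G) = ∑ v, b.1 v • R.point v := rfl

theorem sum_homeomorph_symm_smul (x : R.complex.space) :
    ∑ v, (R.homeomorph.symm x).1 v • R.point v = x := by
  rw [← R.coe_homeomorph, Homeomorph.apply_symm_apply]

theorem homeomorph_symm_eq {x : R.complex.space} {b : V → ℝ} (hb : b ∈ A.polyhedron)
    (h : (x : G) = ∑ v, b v • R.point v) : R.homeomorph.symm x = ⟨b, hb⟩ := by
  rw [Homeomorph.symm_apply_eq]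
  exact Subtype.ext h

end Topology

end GeometricRealization

/-- A geometric simplicial complex as a realization of its underlying abstract complex. -/
def Geometry.SimplicialComplex.realization {E : Type*} [AddCommGroup E] [Module ℝ E]
    (K : SimplicialComplex ℝ E) : GeometricRealization K.underlying E where
  complex := K
  point := Subtype.val
  point_injective := Subtype.val_injective
  faces_eq := by
    classical
    ext s
    constructor
    · intro hs
      have hv : ∀ x ∈ s, x ∈ K.vertices := fun x hx =>
        K.down_closed hs (Finset.singleton_subset_iff.2 hx) (Finset.singleton_nonempty x)
      have hmap : (s.subtype (· ∈ K.vertices)).map (Function.Embedding.subtype _) = s :=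
        Finset.subtype_map_of_mem hv
      refine ⟨s.subtype (· ∈ K.vertices), ?_, ?_⟩
      · change Finset.map _ _ ∈ K.faces
        rwa [hmap]
      · refine Eq.trans ?_ hmap
        ext x
        simp
    · rintro ⟨t, ht, rfl⟩
      dsimp only
      convert (show t.map (Function.Embedding.subtype _) ∈ K.faces from ht) using 1
      ext x
      simp

theorem Geometry.SimplicialComplex.finite_vertices {E : Type*} [AddCommGroup E] [Module ℝ E]
    {K : SimplicialComplex ℝ E} (hK : K.faces.Finite) : K.vertices.Finite :=
  Set.Finite.preimage Finset.singleton_injective.injOn hK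

/-! ### The topmost part of a distribution of masses -/

section TopPart

variable {V : Type*} [Fintype V] [LinearOrder V]

/-- Masses `b v` are placed at the points `v` of a finite linear order, and `t` units of mass are
selected from the top downwards; `topPart b t v` is the mass selected at `v`. -/
def topPart (b : V → ℝ) (t : ℝ) (v : V) : ℝ :=
  min t (∑ u with v ≤ u, b u) - min t (∑ u with v < u, b u)

theorem sum_filter_le_eq_add (b : V → ℝ) (v : V) :
    ∑ u with v ≤ u, b u = b v + ∑ u with v < u, b u := by
  rw [← Finset.sum_insert (by simp)]
  congr 1
  ext u
  simp [le_iff_eq_or_lt, eq_comm]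

theorem topPart_zero_right {b : V → ℝ} (hb : ∀ v, 0 ≤ b v) (v : V) : topPart b 0 v = 0 := by
  rw [topPart, min_eq_left (Finset.sum_nonneg fun u _ => hb u),
    min_eq_left (Finset.sum_nonneg fun u _ => hb u), sub_self]

theorem topPart_zero_left {t : ℝ} (v : V) : topPart (0 : V → ℝ) t v = 0 := by
  simp [topPart]

theorem topPart_nonneg {b : V → ℝ} (hb : ∀ v, 0 ≤ b v) (t : ℝ) (v : V) : 0 ≤ topPart b t v := by
  have h := sum_filter_le_eq_add b v
  have := hb v
  exact sub_nonneg.2 (min_le_min_left _ (by linarith))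

theorem topPart_le {b : V → ℝ} (hb : ∀ v, 0 ≤ b v) (t : ℝ) (v : V) : topPart b t v ≤ b v := by
  have h := sum_filter_le_eq_add b v
  have := hb v
  rw [topPart, h]
  rcases le_total t (∑ u with v < u, b u) with h | h
  · rw [min_eq_left h, min_eq_left (by linarith)]
    linarith
  · rw [min_eq_right h]
    linarith [min_le_right t (b v + ∑ u with v < u, b u)]

theorem topPart_of_sum_le {b : V → ℝ} (hb : ∀ v, 0 ≤ b v) {t : ℝ} (ht : ∑ v, b v ≤ t) (v : V) :
    topPart b t v = b v := by
  have h : ∀ s : Finset V, ∑ u ∈ s, b u ≤ t := fun s =>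
    (Finset.sum_le_sum_of_subset_of_nonneg (Finset.subset_univ s) fun u _ _ => hb u).trans ht
  rw [topPart, min_eq_right (h _), min_eq_right (h _), sum_filter_le_eq_add]
  ring

theorem sum_topPart_of_isUpperSet {b : V → ℝ} {t : ℝ} (ht : 0 ≤ t) (s : Finset V) :
    IsUpperSet (s : Set V) → ∑ v ∈ s, topPart b t v = min t (∑ v ∈ s, b v) := by
  induction s using Finset.induction_on_min with
  | empty => simp [ht]
  | insert a s has ih =>
    intro hs
    have ha : a ∉ s := fun h => lt_irrefl _ (has a h)
    have hgt : Finset.univ.filter (a < ·) = s := by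
      ext u
      simp only [Finset.mem_filter, Finset.mem_univ, true_and]
      refine ⟨fun h => ?_, has u⟩
      have hu : u ∈ insert a s :=
        Finset.mem_coe.1 (hs h.le (Finset.mem_coe.2 (Finset.mem_insert_self a s)))
      exact (Finset.mem_insert.1 hu).resolve_left h.ne'
    have hup : IsUpperSet (s : Set V) := by
      intro u v huv hu
      rw [← hgt] at hu ⊢
      simp only [Finset.coe_filter, Finset.mem_univ, true_and, Set.mem_ofPred_eq] at hu ⊢
      exact hu.trans_le huv
    rw [Finset.sum_insert ha, ih hup, Finset.sum_insert ha, topPart, sum_filter_le_eq_add, hgt]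
    ring

theorem sum_topPart {b : V → ℝ} {t : ℝ} (ht : 0 ≤ t) :
    ∑ v, topPart b t v = min t (∑ v, b v) :=
  sum_topPart_of_isUpperSet ht _ (by simpa using isUpperSet_univ)

/-- Mass is selected at `v` only after everything above `v` has been used up. -/
theorem le_of_topPart_ne_zero {b : V → ℝ} (hb : ∀ v, 0 ≤ b v) {t : ℝ} {u v : V}
    (hv : topPart b t v ≠ 0) (hu : topPart b t u ≠ b u) : u ≤ v := by
  by_contra! huv
  have hle : ∑ w with u ≤ w, b w ≤ ∑ w with v < w, b w :=
    Finset.sum_le_sum_of_subset_of_nonneg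
      (Finset.monotone_filter_right _ fun w _ hw => huv.trans_le hw) fun w _ _ => hb w
  have hlt : ∑ w with v < w, b w < t := by
    by_contra! h
    have h' := sum_filter_le_eq_add b v
    exact hv (by rw [topPart, min_eq_left h, min_eq_left (by linarith [hb v]), sub_self])
  have h' := sum_filter_le_eq_add b u
  refine hu ?_
  rw [topPart, min_eq_right (by linarith), min_eq_right (by linarith [hb u])]
  linarith

/-- `topPart b t` is the only way to select `t` units of mass from the top downwards. -/
theorem eq_topPart {b c : V → ℝ} {t : ℝ} (hc0 : ∀ v, 0 ≤ c v) (hcb : ∀ v, c v ≤ b v)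
    (hsum : ∑ v, c v = t) (h : ∀ u v, c v ≠ 0 → c u ≠ b u → u ≤ v) : c = topPart b t := by
  -- The two agree on every upper set, hence at every point.
  have key : ∀ s : Finset V, IsUpperSet (s : Set V) → ∑ v ∈ s, c v = min t (∑ v ∈ s, b v) := by
    intro s hs
    by_cases hcs : ∀ u ∈ s, c u = b u
    · rw [← Finset.sum_congr rfl hcs, min_eq_right]
      rw [← hsum]
      exact Finset.sum_le_sum_of_subset_of_nonneg (Finset.subset_univ s) fun u _ _ => hc0 u
    · push Not at hcs
      obtain ⟨u, hus, hu⟩ := hcs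
      have ht : ∑ v ∈ s, c v = t := by
        rw [← hsum]
        refine Finset.sum_subset (Finset.subset_univ s) fun v _ hv => ?_
        by_contra hcv
        exact hv (Finset.mem_coe.1 (hs (h u v hcv hu) (Finset.mem_coe.2 hus)))
      rw [ht, min_eq_left]
      rw [← ht]
      exact Finset.sum_le_sum fun v _ => hcb v
  funext v
  have h1 := key (Finset.univ.filter (v ≤ ·)) (fun x y hxy hx => by
    simp only [Finset.coe_filter, Finset.mem_univ, true_and, Set.mem_ofPred_eq] at hx ⊢
    exact hx.trans hxy)
  have h2 := key (Finset.univ.filter (v < ·)) (fun x y hxy hx => by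
    simp only [Finset.coe_filter, Finset.mem_univ, true_and, Set.mem_ofPred_eq] at hx ⊢
    exact hx.trans_le hxy)
  rw [topPart, ← h1, ← h2, sum_filter_le_eq_add]
  ring

theorem continuous_topPart : Continuous fun p : (V → ℝ) × ℝ => topPart p.1 p.2 := by
  unfold topPart
  fun_prop

end TopPart

/-! ### Coordinates on the ordered product with the interval -/

/-- The coordinates, in the ordered product triangulation of `|A| × [0, 1]`, of the point with
barycentric coordinates `b` and height `t`: the topmost `t` units of mass lie in the outer layer,
the rest in the inner one. -/
def prodCoord {V : Type*} [Fintype V] [LinearOrder V] (b : V → ℝ) (t : ℝ) (a : V × Fin 2) : ℝ :=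
  if a.2 = 0 then b a.1 - topPart b t a.1 else topPart b t a.1

theorem AbstractSimplicialComplex.mem_prodI_faces {V : Type*} [LinearOrder V]
    {A : AbstractSimplicialComplex V} {s : Finset (V × Fin 2)} :
    s ∈ A.prodI.faces ↔
      (∀ u v, (u, 0) ∈ s → (v, 1) ∈ s → u ≤ v) ∧ s.image Prod.fst ∈ A.faces := by
  constructor
  · rintro ⟨hc, hA, -⟩
    refine ⟨fun u v hu hv => ?_, hA⟩
    rcases hc.total (Finset.mem_coe.2 hu) (Finset.mem_coe.2 hv) with h | h
    · exact h.1
    · exact absurd h.2 (by simp)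
  · rintro ⟨h, hA⟩
    refine ⟨?_, hA, ?_⟩
    · rintro ⟨u, i⟩ hu ⟨v, j⟩ hv -
      have hu := Finset.mem_coe.1 hu
      have hv := Finset.mem_coe.1 hv
      fin_cases i <;> fin_cases j
      · simpa using le_total u v
      · exact Or.inl ⟨h u v hu hv, by simp⟩
      · exact Or.inr ⟨h v u hv hu, by simp⟩
      · simpa using le_total u v
    · have := (A.isRelLowerSet_faces hA).1
      exact (Finset.image_nonempty.1 this).image _

section ProdCoord

theorem sum_prod_fin_two {V G : Type*} [Fintype V] [AddCommMonoid G] (g : V × Fin 2 → G) :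
    ∑ a, g a = ∑ v, (g (v, 0) + g (v, 1)) := by
  simp [Fintype.sum_prod_type]

variable {V : Type*} [Fintype V] [LinearOrder V] {A : AbstractSimplicialComplex V}

theorem prodCoord_mem_polyhedron {b : V → ℝ} (hb : b ∈ A.polyhedron) (t : ℝ) :
    prodCoord b t ∈ A.prodI.polyhedron := by
  obtain ⟨h0, h1, s, hs, hbs⟩ := hb
  have hsum : ∑ a, prodCoord b t a = 1 := by
    simp [sum_prod_fin_two, prodCoord, h1]
  refine ⟨?_, hsum, Finset.univ.filter (prodCoord b t · ≠ 0), ?_, by simp⟩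
  · rintro ⟨v, i⟩
    unfold prodCoord
    split_ifs
    · exact sub_nonneg.2 (topPart_le h0 t v)
    · exact topPart_nonneg h0 t v
  · refine AbstractSimplicialComplex.mem_prodI_faces.2 ⟨fun u v hu hv => ?_, ?_⟩
    · have hu : b u - topPart b t u ≠ 0 := (Finset.mem_filter.1 hu).2
      have hv : topPart b t v ≠ 0 := (Finset.mem_filter.1 hv).2
      exact le_of_topPart_ne_zero h0 hv fun h => hu (by rw [h, sub_self])
    · refine (A.isRelLowerSet_faces hs).2 ?_ ?_
      · intro v hv
        obtain ⟨⟨v, i⟩, ha, rfl⟩ := Finset.mem_image.1 hv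
        by_contra hvs
        have hz : topPart b t v = 0 :=
          le_antisymm ((topPart_le h0 t v).trans (hbs v hvs).le) (topPart_nonneg h0 t v)
        exact (Finset.mem_filter.1 ha).2 (by simp [prodCoord, hz, hbs v hvs])
      · obtain ⟨a, -, ha⟩ := Finset.exists_ne_zero_of_sum_ne_zero
          (hsum.trans_ne one_ne_zero)
        exact ⟨a.1, Finset.mem_image_of_mem _ (by simpa using ha)⟩

theorem sum_prodCoord_smul_fst {E : Type*} [AddCommGroup E] [Module ℝ E] (b : V → ℝ) (t : ℝ)
    (p : V → E) : ∑ a, prodCoord b t a • p a.1 = ∑ v, b v • p v := by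
  simp [sum_prod_fin_two, prodCoord, ← add_smul]

theorem sum_prodCoord_mul_snd {b : V → ℝ} (h1 : ∑ v, b v = 1) {t : ℝ} (ht : t ∈ Set.Icc 0 1) :
    ∑ a, prodCoord b t a * ((a.2 : ℕ) : ℝ) = t := by
  simp [sum_prod_fin_two, prodCoord, sum_topPart ht.1, h1, ht.2]

/-- The marginal on `|A|` of a point of the ordered product. -/
theorem fst_mem_polyhedron {c : V × Fin 2 → ℝ} (hc : c ∈ A.prodI.polyhedron) :
    (fun v => c (v, 0) + c (v, 1)) ∈ A.polyhedron := by
  obtain ⟨h0, h1, s, hs, hcs⟩ := hc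
  refine ⟨fun v => add_nonneg (h0 _) (h0 _), by rw [← sum_prod_fin_two, h1], _,
    (AbstractSimplicialComplex.mem_prodI_faces.1 hs).2, fun v hv => ?_⟩
  have h : ∀ i, (v, i) ∉ s := fun i hi => hv (Finset.mem_image_of_mem Prod.fst hi)
  simp [hcs _ (h 0), hcs _ (h 1)]

/-- A point of the ordered product is determined by its projections to `|A|` and `[0, 1]`. -/
theorem prodCoord_projections {c : V × Fin 2 → ℝ} (hc : c ∈ A.prodI.polyhedron) :
    prodCoord (fun v => c (v, 0) + c (v, 1)) (∑ a, c a * ((a.2 : ℕ) : ℝ)) = c := by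
  obtain ⟨h0, h1, s, hs, hcs⟩ := hc
  have hmem : ∀ {a}, c a ≠ 0 → a ∈ s := fun {a} h => by_contra fun ha => h (hcs a ha)
  have key : (fun v => c (v, 1)) = topPart (fun v => c (v, 0) + c (v, 1))
      (∑ a, c a * ((a.2 : ℕ) : ℝ)) := by
    refine eq_topPart (fun v => h0 _) (fun v => by linarith [h0 (v, 0)])
      (by simp [sum_prod_fin_two]) fun u v hv hu => ?_
    exact (AbstractSimplicialComplex.mem_prodI_faces.1 hs).1 u v
      (hmem fun h => hu (by simp [h])) (hmem hv)
  funext ⟨v, i⟩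
  have hv := congrFun key v
  fin_cases i <;> simp [prodCoord, ← hv]

end ProdCoord

/-! ### The flow on the simplicial mapping cylinder -/

open Classical in
theorem mem_simplicialMappingCylinder_faces {V W : Type*} [LinearOrder V]
    {A : AbstractSimplicialComplex V} {B : AbstractSimplicialComplex W} {f : V → W}
    {s : Finset (V ⊕ W)} :
    s ∈ (simplicialMappingCylinder A B f).faces ↔
      (∃ t ∈ B.faces, t.image Sum.inr = s) ∨
        ∃ t ∈ A.prodI.faces, t.image (cylinderVertexMap f) = s :=
  Iff.rfl

section Flow

variable {V W : Type*} [Fintype V] [Fintype W] {f : V → W}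

/-- The retraction of the simplicial mapping cylinder onto its base: the mass at each vertex `v` of
the inner layer is moved to `f v`. -/
noncomputable def cylinderRetraction (f : V → W) (c : V ⊕ W → ℝ) : W → ℝ :=
  fun w => c (Sum.inr w) + FunOnFinite.map f (c ∘ Sum.inl) w

theorem continuous_cylinderRetraction : Continuous (cylinderRetraction f) := by
  refine continuous_pi fun w => (continuous_apply _).add ((continuous_apply w).comp
    ((FunOnFinite.continuous_map ℝ f).comp ?_))
  unfold Function.comp
  fun_prop

theorem cylinderRetraction_sumElim (f : V → W) (b : V → ℝ) :
    cylinderRetraction f (Sum.elim b 0) = FunOnFinite.map f b := by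
  ext w
  simp [cylinderRetraction]

theorem cylinderRetraction_sumElim_zero (f : V → W) (c : W → ℝ) :
    cylinderRetraction f (Sum.elim (0 : V → ℝ) c) = c := by
  classical
  ext w
  simp [cylinderRetraction, FunOnFinite.map_apply_apply]

variable [LinearOrder V] {A : AbstractSimplicialComplex V} {B : AbstractSimplicialComplex W}

/-- The flow of the simplicial mapping cylinder onto its base: at time `t`, the topmost `t` units
of the mass in the inner layer have been carried along `f` to the base. -/
noncomputable def cylinderFlow (f : V → W) (c : V ⊕ W → ℝ) (t : ℝ) : V ⊕ W → ℝ :=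
  Sum.elim (fun v => c (Sum.inl v) - topPart (c ∘ Sum.inl) t v)
    (fun w => c (Sum.inr w) + FunOnFinite.map f (topPart (c ∘ Sum.inl) t) w)

theorem continuous_cylinderFlow :
    Continuous fun p : (V ⊕ W → ℝ) × ℝ => cylinderFlow f p.1 p.2 := by
  have htop : Continuous fun p : (V ⊕ W → ℝ) × ℝ => topPart (p.1 ∘ Sum.inl) p.2 :=
    continuous_topPart.comp (f := fun p : (V ⊕ W → ℝ) × ℝ => (p.1 ∘ Sum.inl, p.2))
      (by unfold Function.comp; fun_prop)
  refine continuous_pi ?_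
  rintro (v | w)
  · exact ((continuous_apply _).comp continuous_fst).sub ((continuous_apply v).comp htop)
  · exact ((continuous_apply _).comp continuous_fst).add
      ((continuous_apply w).comp ((FunOnFinite.continuous_map ℝ f).comp htop))

theorem cylinderFlow_zero {c : V ⊕ W → ℝ} (h0 : ∀ a, 0 ≤ c a) : cylinderFlow f c 0 = c := by
  classical
  ext (v | w)
  · simp [cylinderFlow, topPart_zero_right (b := c ∘ Sum.inl) (fun v => h0 _)]
  · simp [cylinderFlow, FunOnFinite.map_apply_apply,
      topPart_zero_right (b := c ∘ Sum.inl) (fun v => h0 _)]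

theorem cylinderFlow_one {c : V ⊕ W → ℝ} (h0 : ∀ a, 0 ≤ c a) (h1 : ∑ a, c a = 1) :
    cylinderFlow f c 1 = Sum.elim (0 : V → ℝ) (cylinderRetraction f c) := by
  have hle : ∑ v, (c ∘ Sum.inl) v ≤ 1 := by
    rw [Fintype.sum_sum_type] at h1
    have := Finset.sum_nonneg fun (w : W) (_ : w ∈ Finset.univ) => h0 (Sum.inr w)
    simp only [Function.comp]
    linarith
  have htop : topPart (c ∘ Sum.inl) 1 = c ∘ Sum.inl :=
    funext fun v => topPart_of_sum_le (fun v => h0 _) hle v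
  ext (v | w) <;> simp [cylinderFlow, cylinderRetraction, htop]

theorem cylinderRetraction_cylinderFlow (c : V ⊕ W → ℝ) (t : ℝ) :
    cylinderRetraction f (cylinderFlow f c t) = cylinderRetraction f c := by
  classical
  ext w
  simp [cylinderRetraction, cylinderFlow, FunOnFinite.map_apply_apply]

theorem sum_cylinderFlow_smul {G : Type*} [AddCommGroup G] [Module ℝ G] (b : V → ℝ) (t : ℝ)
    (p : V ⊕ W → G) :
    ∑ x, cylinderFlow f (Sum.elim b 0) t x • p x =
      ∑ a, prodCoord b t a • p (cylinderVertexMap f a) := by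
  simp [Fintype.sum_sum_type, sum_prod_fin_two, cylinderFlow, prodCoord, cylinderVertexMap,
    FunOnFinite.sum_map_smul, Finset.sum_add_distrib]

theorem sumElim_zero_right_mem_polyhedron {b : V → ℝ} (hb : b ∈ A.polyhedron) :
    Sum.elim b 0 ∈ (simplicialMappingCylinder A B f).polyhedron := by
  classical
  obtain ⟨h0, h1, s, hs, hbs⟩ := hb
  refine ⟨?_, by simp [Fintype.sum_sum_type, h1], (s.image fun v => (v, (0 : Fin 2))).image
    (cylinderVertexMap f), mem_simplicialMappingCylinder_faces.2 (Or.inr ⟨_, ?_, rfl⟩), ?_⟩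
  · rintro (v | w)
    exacts [h0 v, le_rfl]
  · refine AbstractSimplicialComplex.mem_prodI_faces.2 ⟨fun u v hu hv => by simp at hv, ?_⟩
    convert hs using 1
    ext v
    simp
  · rintro (v | w) h
    · refine hbs v fun hv => h ?_
      simpa [cylinderVertexMap] using hv
    · rfl

theorem sumElim_zero_left_mem_polyhedron {c : W → ℝ} (hc : c ∈ B.polyhedron) :
    Sum.elim (0 : V → ℝ) c ∈ (simplicialMappingCylinder A B f).polyhedron := by
  classical
  obtain ⟨h0, h1, s, hs, hcs⟩ := hc
  refine ⟨?_, by simp [Fintype.sum_sum_type, h1], s.image Sum.inr,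
    mem_simplicialMappingCylinder_faces.2 (Or.inl ⟨s, hs, rfl⟩), ?_⟩
  · rintro (v | w)
    exacts [le_rfl, h0 w]
  · rintro (v | w) h
    · rfl
    · exact hcs w fun hw => h (Finset.mem_image_of_mem _ hw)

theorem cylinderRetraction_mem_polyhedron
    (hf : ∀ s ∈ A.faces, ∃ t ∈ B.faces, ∀ v ∈ s, f v ∈ t)
    {c : V ⊕ W → ℝ} (hc : c ∈ (simplicialMappingCylinder A B f).polyhedron) :
    cylinderRetraction f c ∈ B.polyhedron := by
  classical
  obtain ⟨h0, h1, s, hs, hcs⟩ := hc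
  refine ⟨fun w => add_nonneg (h0 _) (FunOnFinite.map_nonneg f (fun v => h0 _) w), ?_, ?_⟩
  · simp only [cylinderRetraction, Finset.sum_add_distrib, FunOnFinite.sum_map, Function.comp]
    rw [add_comm, ← Fintype.sum_sum_type, h1]
  -- The retraction is carried by the image of `s` under the vertex map `Sum.elim f id`.
  have hzero : ∀ t : Finset W, (∀ a ∈ s, Sum.elim f id a ∈ t) →
      ∀ w ∉ t, cylinderRetraction f c w = 0 := by
    intro t ht w hw
    have hr : c (Sum.inr w) = 0 := hcs _ fun h => hw (ht _ h)
    have hl : FunOnFinite.map f (c ∘ Sum.inl) w = 0 := by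
      by_contra h
      obtain ⟨v, rfl, hv⟩ := FunOnFinite.exists_of_map_ne_zero h
      exact hv (hcs _ fun h => hw (ht _ h))
    rw [cylinderRetraction, hr, hl, add_zero]
  rcases mem_simplicialMappingCylinder_faces.1 hs with ⟨t, ht, rfl⟩ | ⟨t, ht, rfl⟩
  · exact ⟨t, ht, hzero t (by simp)⟩
  · obtain ⟨t', ht', hft⟩ := hf _ (AbstractSimplicialComplex.mem_prodI_faces.1 ht).2
    refine ⟨t', ht', hzero _ ?_⟩
    intro a ha
    obtain ⟨⟨v, i⟩, hv, rfl⟩ := Finset.mem_image.1 ha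
    have : Sum.elim f id (cylinderVertexMap f (v, i)) = f v := by
      unfold cylinderVertexMap
      split_ifs <;> rfl
    rw [this]
    exact hft v (Finset.mem_image_of_mem Prod.fst hv)

/-- The flow stays inside the complex. On the image of a simplex `s` of `A × I`, the mass left in
the inner layer lies below both the mass carried over and the vertices of `s` in the outer layer,
so the vertices in use still form the image of a chain. -/
theorem cylinderFlow_mem_polyhedron {c : V ⊕ W → ℝ}
    (hc : c ∈ (simplicialMappingCylinder A B f).polyhedron) (t : ℝ) :
    cylinderFlow f c t ∈ (simplicialMappingCylinder A B f).polyhedron := by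
  classical
  obtain ⟨h0, h1, s, hs, hcs⟩ := hc
  set b : V → ℝ := c ∘ Sum.inl with hb
  have hb0 : ∀ v, 0 ≤ b v := fun v => h0 _
  have hsum : ∑ a, cylinderFlow f c t a = 1 := by
    rw [← h1, Fintype.sum_sum_type, Fintype.sum_sum_type]
    simp only [cylinderFlow, Sum.elim_inl, Sum.elim_inr, Finset.sum_add_distrib,
      Finset.sum_sub_distrib, FunOnFinite.sum_map]
    ring
  refine ⟨?_, hsum, ?_⟩
  · rintro (v | w)
    · exact sub_nonneg.2 (topPart_le hb0 t v)
    · exact add_nonneg (h0 _) (FunOnFinite.map_nonneg f (topPart_nonneg hb0 t) w)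
  rcases mem_simplicialMappingCylinder_faces.1 hs with ⟨s, hs', rfl⟩ | ⟨s, hs', rfl⟩
  · refine ⟨_, hs, ?_⟩
    have hbz : b = 0 := by
      funext v
      exact hcs _ (by simp)
    have hflow : cylinderFlow f c t = c := by
      ext (v | w) <;>
        simp [cylinderFlow, ← hb, hbz, topPart_zero_left, FunOnFinite.map_apply_apply]
    rwa [hflow]
  · obtain ⟨hchain, hproj⟩ := AbstractSimplicialComplex.mem_prodI_faces.1 hs'
    have hinl : ∀ v, b v ≠ 0 → (v, 0) ∈ s := by
      intro v hv
      have : Sum.inl v ∈ s.image (cylinderVertexMap f) := by_contra fun h => hv (hcs _ h)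
      obtain ⟨⟨u, i⟩, hu, huv⟩ := Finset.mem_image.1 this
      unfold cylinderVertexMap at huv
      split_ifs at huv with hi
      dsimp only at hi huv
      rwa [← Sum.inl.inj huv, ← hi]
    have htop : ∀ v, topPart b t v ≠ 0 → (v, 0) ∈ s := fun v hv =>
      hinl v fun h => hv (le_antisymm ((topPart_le hb0 t v).trans h.le) (topPart_nonneg hb0 t v))
    let r : Finset (V × Fin 2) := Finset.univ.filter fun a =>
      (a.2 = 0 ∧ topPart b t a.1 ≠ b a.1) ∨ (a.2 = 1 ∧ (topPart b t a.1 ≠ 0 ∨ a ∈ s))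
    have hr0 : ∀ {v}, (v, 0) ∈ r ↔ topPart b t v ≠ b v := by simp [r]
    have hr1 : ∀ {v}, (v, 1) ∈ r ↔ topPart b t v ≠ 0 ∨ (v, 1) ∈ s := by simp [r]
    have hb_of : ∀ {v}, topPart b t v ≠ b v → (v, 0) ∈ s := fun {v} h =>
      hinl v fun h' => h (by
        rw [h']
        exact le_antisymm ((topPart_le hb0 t v).trans h'.le) (topPart_nonneg hb0 t v))
    have hvanish : ∀ a ∉ r.image (cylinderVertexMap f), cylinderFlow f c t a = 0 := by
      rintro (v | w) ha
      · by_contra h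
        refine ha (Finset.mem_image.2 ⟨(v, 0), hr0.2 fun h' => h ?_, by simp [cylinderVertexMap]⟩)
        simp only [cylinderFlow, Sum.elim_inl, ← hb, h']
        simp [hb]
      · have hcw : c (Sum.inr w) = 0 := by
          refine hcs _ fun hw => ha ?_
          obtain ⟨⟨u, i⟩, hu, huw⟩ := Finset.mem_image.1 hw
          refine Finset.mem_image.2 ⟨(u, i), ?_, huw⟩
          fin_cases i
          · simp [cylinderVertexMap] at huw
          · exact hr1.2 (Or.inr hu)
        have hmap : FunOnFinite.map f (topPart b t) w = 0 := by
          by_contra h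
          obtain ⟨v, rfl, hv⟩ := FunOnFinite.exists_of_map_ne_zero h
          exact ha (Finset.mem_image.2 ⟨(v, 1), hr1.2 (Or.inl hv), by simp [cylinderVertexMap]⟩)
        simp only [cylinderFlow, Sum.elim_inr, ← hb, hcw, hmap, add_zero]
    refine ⟨_, mem_simplicialMappingCylinder_faces.2 (Or.inr ⟨r, ?_, rfl⟩), hvanish⟩
    refine AbstractSimplicialComplex.mem_prodI_faces.2 ⟨fun u v hu hv => ?_, ?_⟩
    · rcases hr1.1 hv with hv | hv
      · exact le_of_topPart_ne_zero hb0 hv (hr0.1 hu)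
      · exact hchain u v (hb_of (hr0.1 hu)) hv
    · refine (A.isRelLowerSet_faces hproj).2 ?_ ?_
      · intro v hv
        obtain ⟨⟨v, i⟩, ha, rfl⟩ := Finset.mem_image.1 hv
        fin_cases i
        · exact Finset.mem_image_of_mem Prod.fst (hb_of (hr0.1 ha))
        · rcases hr1.1 ha with h | h
          · exact Finset.mem_image.2 ⟨_, htop v h, rfl⟩
          · exact Finset.mem_image_of_mem Prod.fst h
      · obtain ⟨x, -, hx⟩ := Finset.exists_ne_zero_of_sum_ne_zero (hsum.trans_ne one_ne_zero)
        have : x ∈ r.image (cylinderVertexMap f) := by_contra fun h => hx (hvanish x h)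
        obtain ⟨a, ha, -⟩ := Finset.mem_image.1 this
        exact ⟨a.1, Finset.mem_image_of_mem _ ha⟩

end Flow

/-! ### The topological mapping cylinder -/

namespace MappingCylinder

variable {X Y : Type*} {f : X → Y}

theorem mk_inl_one (x : X) :
    MappingCylinder.mk f (Sum.inl (x, 1)) = MappingCylinder.mk f (Sum.inr (f x)) :=
  Quot.sound (Rel.glue x)

variable [TopologicalSpace X] [TopologicalSpace Y]

theorem isQuotientMap_mk : Topology.IsQuotientMap (MappingCylinder.mk f) := isQuotientMap_quot_mk

/-- Sliding along the unit interval deforms the mapping cylinder onto its base. -/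
theorem homotopic_id_of_collapse (r : C(MappingCylinder f, MappingCylinder f))
    (hinl : ∀ x t, r (mk f (Sum.inl (x, t))) = mk f (Sum.inr (f x)))
    (hinr : ∀ y, r (mk f (Sum.inr y)) = mk f (Sum.inr y)) :
    r.Homotopic (ContinuousMap.id _) := by
  -- `σ (σ τ * σ t)` moves linearly from `t` to `1`.
  let slide : (X × unitInterval) ⊕ Y → unitInterval → MappingCylinder f := fun z τ =>
    Sum.elim (fun p => mk f (Sum.inl (p.1, unitInterval.symm
      (unitInterval.symm τ * unitInterval.symm p.2)))) (fun y => mk f (Sum.inr y)) z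
  have hslide : ∀ z z', Rel f z z' → slide z = slide z' := by
    rintro _ _ ⟨x⟩
    funext τ
    simp [slide, mk_inl_one]
  let H : unitInterval × MappingCylinder f → MappingCylinder f :=
    fun p => Quot.lift slide hslide p.2 p.1
  have hH : Continuous H := by
    refine isQuotientMap_mk.continuous_lift_prod_right ?_
    have hmk : Continuous (mk f) := isQuotientMap_mk.continuous
    change Continuous fun p : unitInterval × ((X × unitInterval) ⊕ Y) => slide p.2 p.1
    have hswap : Continuous fun p : ((X × unitInterval) ⊕ Y) × unitInterval => slide p.1 p.2 := by
      rw [← Homeomorph.sumProdDistrib.symm.comp_continuous_iff']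
      refine continuous_sum_dom.2 ⟨hmk.comp (continuous_inl.comp ?_),
        hmk.comp (continuous_inr.comp ?_)⟩
      · exact Continuous.prodMk (continuous_fst.comp continuous_fst)
          (unitInterval.continuous_symm.comp ((unitInterval.continuous_symm.comp
            continuous_snd).mul (unitInterval.continuous_symm.comp
              (continuous_snd.comp continuous_fst))))
      · exact continuous_fst
    exact hswap.comp continuous_swap
  refine ContinuousMap.Homotopic.symm ⟨⟨⟨H, hH⟩, ?_, ?_⟩⟩
  · rintro ⟨⟨x, t⟩ | y⟩
    · change mk f (Sum.inl _) = mk f (Sum.inl _)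
      simp
    · rfl
  · rintro ⟨⟨x, t⟩ | y⟩
    · refine Eq.trans ?_ (hinl x t).symm
      change mk f (Sum.inl _) = _
      simp [mk_inl_one]
    · exact (hinr y).symm

end MappingCylinder

/-! ### Barycentric coordinates of a geometric complex -/

section Bary

variable {E : Type*} [NormedAddCommGroup E] [NormedSpace ℝ E] {K : SimplicialComplex ℝ E}
  [Fintype K.vertices]

/-- The homeomorphism between the points of a geometric complex and their barycentric
coordinates. -/
noncomputable def Geometry.SimplicialComplex.bary (K : SimplicialComplex ℝ E)
    [Fintype K.vertices] : K.space ≃ₜ K.underlying.polyhedron :=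
  K.realization.homeomorph.symm

theorem Geometry.SimplicialComplex.sum_bary_smul (x : K.space) :
    ∑ v, (K.bary x).1 v • (v : E) = x :=
  K.realization.sum_homeomorph_symm_smul x

theorem Geometry.SimplicialComplex.bary_eq {x : K.space} {b : K.vertices → ℝ}
    (hb : b ∈ K.underlying.polyhedron) (h : (x : E) = ∑ v, b v • (v : E)) : (K.bary x).1 = b :=
  congrArg Subtype.val (K.realization.homeomorph_symm_eq hb h)

end Bary

/-! ### The natural map from the topological to the simplicial mapping cylinder -/

theorem GeometricSimplicialMap.exists_face {E F : Type*} [AddCommGroup E] [Module ℝ E]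
    [AddCommGroup F] [Module ℝ F] {K : SimplicialComplex ℝ E} {L : SimplicialComplex ℝ F}
    (f : GeometricSimplicialMap K L) (s : Finset K.vertices) (hs : s ∈ K.underlying.faces) :
    ∃ t ∈ L.underlying.faces, ∀ v ∈ s, f.vertexMap v ∈ t := by
  classical
  exact ⟨_, f.map_faces s hs, fun _ hv => Finset.mem_image_of_mem _ hv⟩

section CylinderMap

variable {E F G : Type*} [NormedAddCommGroup E] [NormedSpace ℝ E]
  [NormedAddCommGroup F] [NormedSpace ℝ F] [NormedAddCommGroup G] [NormedSpace ℝ G]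
  {K : SimplicialComplex ℝ E} {L : SimplicialComplex ℝ F}
  [Fintype K.vertices] [Fintype L.vertices] [LinearOrder K.vertices]

variable (f : GeometricSimplicialMap K L)

theorem GeometricSimplicialMap.bary_apply (x : K.space) :
    (L.bary (f.toFun x)).1 = FunOnFinite.map f.vertexMap (K.bary x).1 := by
  classical
  have hmem : FunOnFinite.map f.vertexMap (K.bary x).1 ∈ L.underlying.polyhedron := by
    rw [← cylinderRetraction_sumElim]
    exact cylinderRetraction_mem_polyhedron f.exists_face
      (sumElim_zero_right_mem_polyhedron (K.bary x).2)
  refine SimplicialComplex.bary_eq hmem ?_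
  obtain ⟨s, hs, hw, hs0⟩ :=
    AbstractSimplicialComplex.exists_face_of_mem_polyhedron (K.bary x).2
  rw [f.map_barycentric s hs _ hw x
    (by rw [sum_smul_eq_sum_univ hs0, SimplicialComplex.sum_bary_smul]),
    sum_smul_eq_sum_univ hs0 (fun v => (f.vertexMap v : F)), FunOnFinite.sum_map_smul]

variable (C : GeometricRealization
  (simplicialMappingCylinder K.underlying L.underlying f.vertexMap) G)

/-- The natural map on the disjoint union `(|K| × [0, 1]) ⊔ |L|`, in barycentric coordinates: a
point at height `t` is the image, under the flow up to time `t`, of the corresponding point of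
the inner layer. -/
noncomputable def cylinderCoord : (K.space × unitInterval) ⊕ L.space →
    (simplicialMappingCylinder K.underlying L.underlying f.vertexMap).polyhedron :=
  Sum.elim
    (fun p => ⟨cylinderFlow f.vertexMap (Sum.elim (K.bary p.1).1 0) p.2,
      cylinderFlow_mem_polyhedron (sumElim_zero_right_mem_polyhedron (K.bary p.1).2) _⟩)
    (fun y => ⟨Sum.elim 0 (L.bary y).1, sumElim_zero_left_mem_polyhedron (L.bary y).2⟩)

theorem continuous_cylinderCoord : Continuous (cylinderCoord f) := by
  refine Continuous.sumElim (Continuous.subtype_mk ?_ _) (Continuous.subtype_mk ?_ _)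
  · refine continuous_cylinderFlow.comp (f := fun p : K.space × unitInterval =>
      ((Sum.elim (K.bary p.1).1 0 : K.vertices ⊕ L.vertices → ℝ), (p.2 : ℝ)))
      (Continuous.prodMk (continuous_pi ?_) (continuous_subtype_val.comp continuous_snd))
    rintro (v | w)
    · exact (continuous_apply v).comp
        (continuous_subtype_val.comp (K.bary.continuous.comp continuous_fst))
    · exact continuous_const
  · refine continuous_pi ?_
    rintro (v | w)
    · exact continuous_const
    · exact (continuous_apply w).comp (continuous_subtype_val.comp L.bary.continuous)

theorem cylinderCoord_glue (x : K.space) :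
    cylinderCoord f (Sum.inl (x, 1)) = cylinderCoord f (Sum.inr (f.toFun x)) := by
  have hx := sumElim_zero_right_mem_polyhedron (B := L.underlying) (f := f.vertexMap)
    (K.bary x).2
  refine Subtype.ext ?_
  change cylinderFlow f.vertexMap (Sum.elim (K.bary x).1 0) 1 = Sum.elim (0 : K.vertices → ℝ) _
  rw [cylinderFlow_one hx.1 hx.2.1, cylinderRetraction_sumElim, f.bary_apply]

theorem cylinderRetraction_cylinderCoord_inl (x : K.space) (t : unitInterval) :
    cylinderRetraction f.vertexMap (cylinderCoord f (Sum.inl (x, t))).1 =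
      (L.bary (f.toFun x)).1 := by
  change cylinderRetraction f.vertexMap (cylinderFlow _ _ _) = _
  rw [cylinderRetraction_cylinderFlow, cylinderRetraction_sumElim, f.bary_apply]

/-- The natural map `M(f) → |Cyl(f)|`. -/
noncomputable def cylinderMap : C(MappingCylinder f.toFun, C.complex.space) where
  toFun := Quot.lift (fun z => C.homeomorph (cylinderCoord f z)) (by
    rintro _ _ ⟨x⟩
    rw [cylinderCoord_glue])
  continuous_toFun := continuous_quot_lift _ (C.homeomorph.continuous.comp
    (continuous_cylinderCoord f))

theorem cylinderMap_mk (z : (K.space × unitInterval) ⊕ L.space) :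
    cylinderMap f C (MappingCylinder.mk f.toFun z) = C.homeomorph (cylinderCoord f z) := rfl

theorem coe_cylinderMap_mk_inl (x : K.space) (t : unitInterval) :
    (cylinderMap f C (MappingCylinder.mk f.toFun (Sum.inl (x, t))) : G) =
      ∑ a, prodCoord (K.bary x).1 t a • C.point (cylinderVertexMap f.vertexMap a) := by
  rw [cylinderMap_mk, C.coe_homeomorph]
  exact sum_cylinderFlow_smul _ _ _

theorem coe_cylinderMap_mk_inr (y : L.space) :
    (cylinderMap f C (MappingCylinder.mk f.toFun (Sum.inr y)) : G) =
      ∑ v, (L.bary y).1 v • C.point (Sum.inr v) := by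
  rw [cylinderMap_mk, C.coe_homeomorph]
  simp [cylinderCoord, Fintype.sum_sum_type]

theorem isCylinderMap_cylinderMap : IsCylinderMap f C (cylinderMap f C) where
  on_prod s hs w hw x t hx ht := by
    have hc := hw.indicator_mem_polyhedron hs
    have hbary : (K.bary x).1 = _ := SimplicialComplex.bary_eq (fst_mem_polyhedron hc) (by
      rw [hx, ← sum_indicator_smul s w (fun a => (a.1 : E)), sum_prod_fin_two]
      simp_rw [add_smul])
    have ht' : (t : ℝ) = ∑ a, (s : Set (K.vertices × Fin 2)).indicator w a * ((a.2 : ℕ) : ℝ) :=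
      ht.trans (sum_indicator_smul s w (fun a => ((a.2 : ℕ) : ℝ))).symm
    rw [coe_cylinderMap_mk_inl, hbary, ht', prodCoord_projections hc, sum_indicator_smul]
  on_base s hs w hw y hy := by
    rw [coe_cylinderMap_mk_inr, SimplicialComplex.bary_eq (hw.indicator_mem_polyhedron hs)
      (by rw [hy, sum_indicator_smul]), sum_indicator_smul]

variable {f C} in
/-- The conditions determine the map, as every point of `|K| × [0, 1]` lies in a simplex of the
ordered product. -/
theorem IsCylinderMap.eq_cylinderMap {q : MappingCylinder f.toFun → C.complex.space}
    (hq : IsCylinderMap f C q) : q = cylinderMap f C := by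
  funext m
  obtain ⟨⟨x, t⟩ | y, rfl⟩ := MappingCylinder.isQuotientMap_mk.surjective m
  · obtain ⟨s, hs, hw, hs0⟩ := AbstractSimplicialComplex.exists_face_of_mem_polyhedron
      (prodCoord_mem_polyhedron (K.bary x).2 t)
    refine Subtype.ext ?_
    rw [coe_cylinderMap_mk_inl, hq.on_prod s hs _ hw x t, sum_smul_eq_sum_univ hs0]
    · rw [sum_smul_eq_sum_univ hs0 (fun a => (a.1 : E)), sum_prodCoord_smul_fst,
        SimplicialComplex.sum_bary_smul]
    · exact ((sum_smul_eq_sum_univ hs0 (fun a => ((a.2 : ℕ) : ℝ))).trans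
        (sum_prodCoord_mul_snd (K.bary x).2.2.1 t.2)).symm
  · obtain ⟨s, hs, hw, hs0⟩ :=
      AbstractSimplicialComplex.exists_face_of_mem_polyhedron (L.bary y).2
    refine Subtype.ext ?_
    rw [coe_cylinderMap_mk_inr, hq.on_base s hs _ hw y, sum_smul_eq_sum_univ hs0]
    rw [sum_smul_eq_sum_univ hs0, SimplicialComplex.sum_bary_smul]

/-! ### The homotopy inverse -/

/-- The homotopy inverse of the natural map: retract the simplicial cylinder onto `|L|` and
include `|L|` in the topological cylinder. -/
noncomputable def cylinderMapInv : C(C.complex.space, MappingCylinder f.toFun) where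
  toFun z := MappingCylinder.mk f.toFun (Sum.inr (L.bary.symm
    ⟨cylinderRetraction f.vertexMap (C.homeomorph.symm z).1,
      cylinderRetraction_mem_polyhedron f.exists_face (C.homeomorph.symm z).2⟩))
  continuous_toFun := MappingCylinder.isQuotientMap_mk.continuous.comp
    (continuous_inr.comp (L.bary.symm.continuous.comp (Continuous.subtype_mk
      (continuous_cylinderRetraction.comp
        (continuous_subtype_val.comp C.homeomorph.symm.continuous)) _)))

theorem cylinderMapInv_eq {z : C.complex.space} {y : L.space}
    (h : cylinderRetraction f.vertexMap (C.homeomorph.symm z).1 = (L.bary y).1) :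
    cylinderMapInv f C z = MappingCylinder.mk f.toFun (Sum.inr y) := by
  change MappingCylinder.mk f.toFun (Sum.inr (L.bary.symm _)) = _
  congr 2
  rw [Homeomorph.symm_apply_eq]
  exact Subtype.ext h

theorem cylinderMapInv_comp_cylinderMap :
    ((cylinderMapInv f C).comp (cylinderMap f C)).Homotopic (ContinuousMap.id _) := by
  refine MappingCylinder.homotopic_id_of_collapse _ (fun x t => ?_) (fun y => ?_)
  · refine cylinderMapInv_eq f C ?_
    rw [cylinderMap_mk, Homeomorph.symm_apply_apply, cylinderRetraction_cylinderCoord_inl]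
  · refine cylinderMapInv_eq f C ?_
    rw [cylinderMap_mk, Homeomorph.symm_apply_apply]
    exact cylinderRetraction_sumElim_zero _ _

theorem cylinderMap_comp_cylinderMapInv :
    ((cylinderMap f C).comp (cylinderMapInv f C)).Homotopic (ContinuousMap.id _) := by
  let H : unitInterval × C.complex.space → C.complex.space := fun p =>
    C.homeomorph ⟨cylinderFlow f.vertexMap (C.homeomorph.symm p.2).1 p.1,
      cylinderFlow_mem_polyhedron (C.homeomorph.symm p.2).2 _⟩
  have hH : Continuous H := C.homeomorph.continuous.comp (Continuous.subtype_mk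
    (continuous_cylinderFlow.comp (Continuous.prodMk
      (continuous_subtype_val.comp (C.homeomorph.symm.continuous.comp continuous_snd))
      (continuous_subtype_val.comp continuous_fst))) _)
  refine ContinuousMap.Homotopic.symm ⟨⟨⟨H, hH⟩, fun z => ?_, fun z => ?_⟩⟩
  · change C.homeomorph _ = z
    rw [← Homeomorph.eq_symm_apply]
    exact Subtype.ext (cylinderFlow_zero (C.homeomorph.symm z).2.1)
  · change C.homeomorph _ = C.homeomorph _
    congr 1
    refine Subtype.ext ?_
    change cylinderFlow _ _ 1 = Sum.elim (0 : K.vertices → ℝ) (L.bary (L.bary.symm _)).1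
    rw [Homeomorph.apply_symm_apply]
    exact cylinderFlow_one (C.homeomorph.symm z).2.1 (C.homeomorph.symm z).2.2.1

end CylinderMap

theorem mainTheorem2 {E F G : Type*} [NormedAddCommGroup E] [NormedSpace ℝ E]
    [NormedAddCommGroup F] [NormedSpace ℝ F] [NormedAddCommGroup G] [NormedSpace ℝ G]
    (K : Geometry.SimplicialComplex ℝ E) (L : Geometry.SimplicialComplex ℝ F)
    (hK : K.faces.Finite) (hL : L.faces.Finite) [LinearOrder K.vertices]
    (f : GeometricSimplicialMap K L)
    (C : GeometricRealization
      (simplicialMappingCylinder K.underlying L.underlying f.vertexMap) G) :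
    (∃! q : C(MappingCylinder f.toFun, C.complex.space), IsCylinderMap f C q) ∧
      ∀ q : C(MappingCylinder f.toFun, C.complex.space), IsCylinderMap f C q →
        ∃ e : ContinuousMap.HomotopyEquiv (MappingCylinder f.toFun) C.complex.space,
          e.toFun = q := by
  have := (SimplicialComplex.finite_vertices hK).fintype
  have := (SimplicialComplex.finite_vertices hL).fintype
  have huniq : ∀ q : C(MappingCylinder f.toFun, C.complex.space), IsCylinderMap f C q →
      q = cylinderMap f C := fun q hq => ContinuousMap.ext (congrFun hq.eq_cylinderMap)
  refine ⟨⟨cylinderMap f C, isCylinderMap_cylinderMap f C, huniq⟩, fun q hq => ?_⟩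
  exact ⟨⟨cylinderMap f C, cylinderMapInv f C, cylinderMapInv_comp_cylinderMap f C,
    cylinderMap_comp_cylinderMapInv f C⟩, (huniq q hq).symm⟩
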